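/- Let $\kappa$ be an uncountable regular cardinal and $\mathbb N=\{1,2,\dots\}$. Let $Fr(\kappa)$ be the free Boolean algebra generated by $(e_{\alpha,n})_{\alpha<\kappa,\,n\in\mathbb N}$, let $\overline{Fr}(\kappa)$ be its Boolean completion and let $L$ be the Stone space of $\overline{Fr}(\kappa)$; for $A\subseteq\kappa$ let $\overline{Fr}(A)\subseteq\overline{Fr}(\kappa)$ be the completion of the subalgebra generated by $(e_{\alpha,n})_{\alpha\in A,\,n\in\mathbb N}$, and let $p_A$ be the map from $L$ onto the Stone space of $\overline{Fr}(A)$ dual to this inclusion. A function $f\in C(L)$ (the Banach algebra and lattice of real continuous functions on $L$) *depends on* $A$ if $p_A(s)=p_A(t)$ implies $f(s)=f(t)$. For $\alpha<\kappa$ put $d_\alpha=\sum_{n\in\mathbb N}2^{-n}\chi_{[e_{\alpha,n}]}$, where $[a]\subseteq L$ is the clopen set corresponding to $a$, and put $d_{1,\alpha}=d_\alpha$ and $d_{-1,\alpha}=1-d_\alpha$. For $\mathcal G\subseteq C(L)$ let $[\mathcal G]$ be the closed real unital subalgebra of $C(L)$ generated by $\mathcal G$. A family $\mathcal F$ of continuous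 functions from $L$ to $[0,1]$ is a *ladder family of length $\kappa$* if there are a set $S$ of ordinals below $\kappa$ of cofinality $\omega$ and, for each $\alpha\in S$, 1. a sequence $(\nu^\alpha_n)_{n\in\mathbb N}$ in $\{-1,1\}$, 2. a strictly increasing sequence $(\eta^\alpha_n)_{n\in\mathbb N}$ of ordinals below $\alpha$ converging to $\alpha$, 3. an ordinal $\beta_\alpha<\alpha$ and a sequence $(f^\alpha_n)_{n\in\mathbb N}$ in $C(L)$ of functions depending on $\beta_\alpha$ such that $f^\alpha_n f^\alpha_m=0$ for $n\neq m$, 4. an infinite set $M_\alpha\subseteq\mathbb N$ with infinite complement, 5. a function $g_\alpha\in C(L)$ which is the supremum of $\{f^\alpha_n\, d_{\nu^\alpha_n,\eta^\alpha_n} : n\in M_\alpha\}$ in the lattice $C(L)$, such that $f^\alpha_n\in[\{d_\gamma:\gamma<\beta_\alpha\}\cup\{g_\gamma:\gamma\in S,\ \gamma<\beta_\alpha\}]$ for all $\alpha\in S$ and $n\in\mathbb N$, and $\mathcal F=\{d_\alpha:\alpha<\kappa\}\cup\{g_\alpha:\alpha\in S\}$. Let $\nabla\mathcal F\subseteq[0,1]^{\mathcal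 F}$ be the image of $L$ under $x\mapsto(f(x))_{f\in\mathcal F}$, with the subspace topology of the product. If $\mathcal F$ is a ladder family of length $\kappa$, then $\nabla\mathcal F$ has no butterfly points; that is, there are no point $x\in\nabla\mathcal F$ and disjoint open sets $U,V\subseteq\nabla\mathcal F$ with $\overline U\cap\overline V=\{x\}$. -/

import Mathlib

open Set Filter Topology TopologicalSpace

universe u v

noncomputable section

namespace Ladder

/-! ### Stone spaces and the Gleason space `L` -/

/-- The Stone space of a Boolean algebra: its points are the Boolean homomorphisms into the
two-element algebra (equivalently, the ultrafilters), with the topology of pointwise convergence. -/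
abbrev StoneSpace (B : Type v) [BooleanAlgebra B] : Type v := BoundedLatticeHom B Bool

instance StoneSpace.topology (B : Type v) [BooleanAlgebra B] : TopologicalSpace (StoneSpace B) :=
  TopologicalSpace.induced (fun t : StoneSpace B => (t : B → Bool)) inferInstance

theorem StoneSpace.continuous_eval {B : Type v} [BooleanAlgebra B] (b : B) :
    Continuous (fun t : StoneSpace B => t b) :=
  (continuous_apply b).comp continuous_induced_dom

theorem StoneSpace.isClosedEmbedding_coe (B : Type v) [BooleanAlgebra B] :
    IsClosedEmbedding (fun t : StoneSpace B => (t : B → Bool)) := by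
  refine ⟨⟨⟨rfl⟩, DFunLike.coe_injective⟩, ?_⟩
  have h : range (fun t : StoneSpace B => (t : B → Bool)) =
      {φ | φ ⊤ = ⊤} ∩ {φ | φ ⊥ = ⊥} ∩ (⋂ a, ⋂ b, {φ | φ (a ⊔ b) = φ a ⊔ φ b}) ∩
        (⋂ a, ⋂ b, {φ | φ (a ⊓ b) = φ a ⊓ φ b}) := by
    ext φ
    simp only [mem_range, mem_inter_iff, mem_ofPred_eq, mem_iInter]
    constructor
    · rintro ⟨t, rfl⟩
      exact ⟨⟨⟨map_top t, map_bot t⟩, map_sup t⟩, map_inf t⟩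
    · rintro ⟨⟨⟨h1, h2⟩, h3⟩, h4⟩
      exact ⟨⟨⟨⟨φ, h3⟩, h4⟩, h1, h2⟩, rfl⟩
  rw [h]
  have c2 : ∀ F : Bool × Bool → Bool, Continuous F := fun _ => continuous_of_discreteTopology
  refine ((IsClosed.inter ?_ ?_).inter ?_).inter ?_
  · exact isClosed_eq (continuous_apply _) continuous_const
  · exact isClosed_eq (continuous_apply _) continuous_const
  · exact isClosed_iInter fun a => isClosed_iInter fun b => isClosed_eq (continuous_apply _)
      (show Continuous ((fun p : Bool × Bool => p.1 ⊔ p.2) ∘ fun φ : B → Bool => (φ a, φ b)) from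
        (c2 _).comp ((continuous_apply a).prodMk (continuous_apply b)))
  · exact isClosed_iInter fun a => isClosed_iInter fun b => isClosed_eq (continuous_apply _)
      (show Continuous ((fun p : Bool × Bool => p.1 ⊓ p.2) ∘ fun φ : B → Bool => (φ a, φ b)) from
        (c2 _).comp ((continuous_apply a).prodMk (continuous_apply b)))

instance StoneSpace.compactSpace (B : Type v) [BooleanAlgebra B] : CompactSpace (StoneSpace B) :=
  (StoneSpace.isClosedEmbedding_coe B).compactSpace

/-- The Cantor cube `{0,1}^(J × ℕ)`. Its algebra of clopen sets is the free Boolean algebra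
`Fr(J)` generated by `(e_{j,n})`, where `e_{j,n}` is the set of all `x` with `x (j, n) = 1`. -/
abbrev Cube (J : Type u) : Type u := J × ℕ → Bool

/-- The Boolean completion of the free Boolean algebra `Fr(J)`: the algebra of regular open subsets
of the Cantor cube (a complete Boolean algebra in which the clopen sets are dense). -/
abbrev FrBar (J : Type u) : Type u := Heyting.Regular (Opens (Cube J))

theorem Cube.isClopen_coord {J : Type u} (j : J) (n : ℕ) :
    IsClopen {x : Cube J | x (j, n) = true} :=
  (isClopen_discrete ({true} : Set Bool)).preimage
    (show Continuous fun x : Cube J => x (j, n) from continuous_apply (j, n))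

/-- The free generator `e_{j,n}` as an element of the completion. -/
def gen {J : Type u} (j : J) (n : ℕ) : FrBar J :=
  ⟨⟨{x : Cube J | x (j, n) = true}, (Cube.isClopen_coord j n).isOpen⟩, by
    have h := Cube.isClopen_coord j n
    apply TopologicalSpace.Opens.ext
    rw [Opens.coe_compl_eq_interior_compl, Opens.coe_compl_eq_interior_compl, Opens.coe_mk,
      h.compl.isOpen.interior_eq, compl_compl, h.isOpen.interior_eq]⟩

/-- The subalgebra `FrBar(A)` of `FrBar(J)` for `A ⊆ J`: the regular open sets which depend only on
the coordinates in `A × ℕ`. -/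
def frBar {J : Type u} (A : Set J) : Set (FrBar J) :=
  {U | ∀ x y : Cube J, (∀ j ∈ A, ∀ n : ℕ, x (j, n) = y (j, n)) →
    x ∈ (U : Opens (Cube J)) → y ∈ (U : Opens (Cube J))}

/-- The extremally disconnected compact Hausdorff space `L`: the Stone space of the completion of
the free Boolean algebra. -/
abbrev L (J : Type u) : Type u := StoneSpace (FrBar J)

/-- The map `p_A` dual to the inclusion of `FrBar(A)` into `FrBar(J)`: the restriction of a Boolean
homomorphism to `FrBar(A)`. -/
def proj {J : Type u} (A : Set J) (t : L J) : frBar A → Bool := fun U => t U.1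

/-- A function on `L` depends on `A` if `p_A s = p_A t` implies `f s = f t`. -/
def DependsOn {J : Type u} (f : C(L J, ℝ)) (A : Set J) : Prop :=
  ∀ s t : L J, proj A s = proj A t → f s = f t

/-! ### The functions `d_α` -/

/-- The Cantor-like surjection `d_j : L → [0,1]`, `d_j = ∑_{n ≥ 1} χ_{e_{j,n}} / 2^n`
(the natural numbers are shifted by one, so that the values are in `[0,1]`). -/
def d {J : Type u} (j : J) : C(L J, ℝ) where
  toFun t := ∑' n : ℕ, (if t (gen j n) = true then (1 : ℝ) else 0) / 2 ^ (n + 1)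
  continuous_toFun := by
    refine continuous_tsum (u := fun n : ℕ => (1 / 2 : ℝ) ^ (n + 1)) (fun n => ?_) ?_ ?_
    · have h : Continuous (fun b : Bool => (if b = true then (1 : ℝ) else 0) / 2 ^ (n + 1)) :=
        continuous_of_discreteTopology
      exact h.comp (StoneSpace.continuous_eval (gen j n))
    · exact (summable_nat_add_iff 1).2 summable_geometric_two
    · intro n t
      rw [norm_div, norm_pow, Real.norm_ofNat, one_div, inv_pow, div_eq_mul_inv]
      refine mul_le_of_le_one_left (by positivity) ?_
      split_ifs <;> simp

/-- `d_{1,j} = d_j` and `d_{-1,j} = 1 - d_j`. -/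
def dSigned {J : Type u} (ν : ℤˣ) (j : J) : C(L J, ℝ) := if ν = 1 then d j else 1 - d j

/-! ### Families of functions -/

/-- The closed real unital subalgebra `[𝓕]` of `C(L)` generated by `𝓕`, the closure being
taken in the supremum norm of `C(L)`. -/
def alg {X : Type u} [TopologicalSpace X] [CompactSpace X] (𝓕 : Set C(X, ℝ)) :
    Subalgebra ℝ C(X, ℝ) :=
  (Algebra.adjoin ℝ 𝓕).topologicalClosure

/-- `∇𝓕`, the image of the space under `x ↦ (f x)_{f ∈ 𝓕}`, with the subspace topology of the
product. If all members of `𝓕` have values in `[0,1]`, this is a subspace of `[0,1]^𝓕`. -/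
def nabla {X : Type u} [TopologicalSpace X] (𝓕 : Set C(X, ℝ)) : Set (𝓕 → ℝ) :=
  range (fun (x : X) (f : 𝓕) => f.1 x)

/-- A butterfly point of a space: a point which is the only common point of the closures of
two disjoint open sets. -/
def IsButterflyPoint {K : Type u} [TopologicalSpace K] (x : K) : Prop :=
  ∃ U V : Set K, IsOpen U ∧ IsOpen V ∧ Disjoint U V ∧ closure U ∩ closure V = {x}

/-! ### Ladder families -/

/-- `𝓕[B] = {d_α | α ∈ B} ∪ {g_α | α ∈ B ∩ S}`. -/
def fragment {J : Type u} (S : Set J) (g : J → C(L J, ℝ)) (B : Set J) : Set C(L J, ℝ) :=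
  d '' B ∪ g '' (B ∩ S)

/-- `𝓕` is the ladder family of length `l` given by the set `S` and the parameters
`ν α`, `η α`, `f α`, `β α`, `M α` (which matter only for `α ∈ S`), with added functions `g α`.
The ordinals below `l` are the elements of `Set.Iio l`; an ordinal `b < l`, as a subset of `l`,
is `Set.Iio b`. -/
structure IsLadderFamilyWith {l : Ordinal.{u}} (𝓕 : Set C(L (Iio l), ℝ)) (S : Set (Iio l))
    (ν : Iio l → ℕ → ℤˣ) (η : Iio l → ℕ → Iio l) (f : Iio l → ℕ → C(L (Iio l), ℝ))
    (β : Iio l → Iio l) (M : Iio l → Set ℕ) (g : Iio l → C(L (Iio l), ℝ)) : Prop where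
  /-- all members of `𝓕` have values in `[0,1]` -/
  mem_unit : ∀ h ∈ 𝓕, ∀ x, h x ∈ Icc (0 : ℝ) 1
  /-- `S` consists of ordinals of countable cofinality -/
  cof_eq : ∀ α ∈ S, (α : Ordinal.{u}).cof = Cardinal.aleph0
  /-- the sequence `η α` in `α` is strictly increasing and converges to `α` -/
  eta_lt : ∀ α ∈ S, ∀ n, η α n < α
  eta_strictMono : ∀ α ∈ S, StrictMono (η α)
  eta_tendsto : ∀ α ∈ S,
    Tendsto (fun n => (η α n : Ordinal.{u})) atTop (𝓝 (α : Ordinal.{u}))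
  /-- the functions `f α n` are pairwise disjoint, depend on `β α < α`, and belong to the algebra
  `[𝓕[β α]]` -/
  f_disjoint : ∀ α ∈ S, ∀ m n, m ≠ n → f α m * f α n = 0
  beta_lt : ∀ α ∈ S, β α < α
  f_dependsOn : ∀ α ∈ S, ∀ n, DependsOn (f α n) (Iio (β α))
  f_mem : ∀ α ∈ S, ∀ n, f α n ∈ alg (fragment S g (Iio (β α)))
  /-- `M α` is infinite and coinfinite -/
  infinite_M : ∀ α ∈ S, (M α).Infinite
  infinite_M_compl : ∀ α ∈ S, (M α)ᶜ.Infinite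
  /-- `g α` is the supremum in the lattice `C(L)` of the functions `f α n * d_{ν α n, η α n}`,
  `n ∈ M α` -/
  isLUB_g : ∀ α ∈ S, IsLUB ((fun n => f α n * dSigned (ν α n) (η α n)) '' M α) (g α)
  /-- `𝓕` is the whole family `{d_α | α < l} ∪ {g_α | α ∈ S}` -/
  eq_fragment : 𝓕 = fragment S g univ

/-- `𝓕` is a ladder family of length `l`. -/
def IsLadderFamily {l : Ordinal.{u}} (𝓕 : Set C(L (Iio l), ℝ)) : Prop :=
  ∃ S ν η f β M g, IsLadderFamilyWith 𝓕 S ν η f β M g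

end Ladder

end

/-! Suppose `U` and `V` witness that `x` is a butterfly point, and pull them back to `L`. Since `L`
is extremally disconnected, the preimages have clopen closures `[a]` and `[b]`
(`exists_closure_eq`). By the countable chain condition `a` and `b` involve only countably many
coordinates (`exists_countable_mem_frBar`), all at most some `α < κ`. So points `s ∈ [a]` and `t ∈
[b]` over `x` stay in `[a]` and `[b]` when they are changed above `α`.

Make both neutral above `α` (`exists_isNeutralAt_of_gt`): every digit there is `c`, and an added
function `g γ` is `0` at the point if all its `f γ n` vanish there. Where some `f γ n` is nonzero,
disjointness determines `g γ` from earlier values (`eq_of_isLUB_disjoint`). By induction the two new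
points agree on all of `𝓕`, so their common image lies in both closures and must be `x`. But `d γ`,
for one `γ > α`, takes the value `c` there, and `c` can be chosen to differ from its value at `x`.

The crux is to make `g δ` vanish without disturbing the point below any `γ < δ`
(`exists_le_of_ladder`). A condition on coordinates up to `γ` leaves the digits of almost all `η δ
n` free. These digits make the only surviving term of the supremum small, and compactness passes to
the limit. -/

noncomputable section

namespace Ladder

section Cube

/-! ### Regular open sets of the Cantor cube -/

variable {J : Type u}

/- The operations of the Boolean algebra `FrBar J` take precedence over those of
`Heyting.Regular`, with which they agree by definition. -/

instance FrBar.instMin : Min (FrBar J) := SemilatticeInf.toMin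

instance FrBar.instCompl : Compl (FrBar J) := BooleanAlgebra.toCompl

instance FrBar.instTop : Top (FrBar J) := BooleanAlgebra.toTop

instance FrBar.instBot : Bot (FrBar J) := BooleanAlgebra.toBot

instance FrBar.instLE : LE (FrBar J) := Preorder.toLE

theorem FrBar.coe_compl (a : FrBar J) : (aᶜ).val = (a.val)ᶜ := rfl

theorem FrBar.coe_bot : (⊥ : FrBar J).val = ⊥ := rfl

/-- The set `W` of points of the cube is determined by the coordinates in `A × ℕ`. -/
def Cube.Saturated (A : Set J) (W : Set (Cube J)) : Prop :=
  ∀ x y : Cube J, (∀ j ∈ A, ∀ n : ℕ, x (j, n) = y (j, n)) → x ∈ W → y ∈ W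

/-- The saturation of a set of points of the cube with respect to the coordinates in `A × ℕ`. -/
def Cube.saturation (A : Set J) (W : Set (Cube J)) : Set (Cube J) :=
  {x | ∃ y ∈ W, ∀ j ∈ A, ∀ n : ℕ, x (j, n) = y (j, n)}

theorem Cube.saturation_saturated (A : Set J) (W : Set (Cube J)) :
    Cube.Saturated A (Cube.saturation A W) := by
  rintro x y hxy ⟨z, hz, hxz⟩
  exact ⟨z, hz, fun j hj n => (hxy j hj n).symm.trans (hxz j hj n)⟩

theorem Cube.subset_saturation (A : Set J) (W : Set (Cube J)) : W ⊆ Cube.saturation A W :=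
  fun x hx => ⟨x, hx, fun _ _ _ => rfl⟩

open Classical in
theorem Cube.isOpen_saturation (A : Set J) {W : Set (Cube J)} (hW : IsOpen W) :
    IsOpen (Cube.saturation A W) := by
  -- Splice: keep `x` on `A` and use a fixed `z` elsewhere. Each splicing map is continuous.
  have h : Cube.saturation A W =
      ⋃ z : Cube J, (fun x : Cube J => fun i : J × ℕ => if i.1 ∈ A then x i else z i) ⁻¹' W := by
    ext x
    simp only [mem_iUnion, mem_preimage]
    constructor
    · rintro ⟨y, hy, hxy⟩
      refine ⟨y, ?_⟩
      convert hy using 1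
      ext ⟨j, n⟩
      by_cases hj : j ∈ A <;> simp [hj, hxy]
    · rintro ⟨z, hz⟩
      exact ⟨_, hz, fun j hj n => by simp [hj]⟩
  rw [h]
  refine isOpen_iUnion fun z => hW.preimage (continuous_pi fun i => ?_)
  by_cases hi : i.1 ∈ A
  · simpa [hi] using continuous_apply i
  · simpa [hi] using continuous_const

theorem Cube.Saturated.interior_compl {A : Set J} {W : Set (Cube J)} (hW : Cube.Saturated A W) :
    Cube.Saturated A (interior Wᶜ) := by
  intro x y hxy hx
  refine mem_interior.2 ⟨Cube.saturation A (interior Wᶜ), ?_,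
    Cube.isOpen_saturation A isOpen_interior, x, hx, fun j hj n => (hxy j hj n).symm⟩
  rintro z ⟨w, hw, hzw⟩ hz
  exact interior_subset hw (hW z w hzw hz)

theorem mem_frBar {A : Set J} {a : FrBar J} :
    a ∈ frBar A ↔ Cube.Saturated A (a : Opens (Cube J)) := Iff.rfl

theorem inf_mem_frBar {A : Set J} {a b : FrBar J} (ha : a ∈ frBar A) (hb : b ∈ frBar A) :
    a ⊓ b ∈ frBar A :=
  fun x y hxy hx => ⟨ha x y hxy hx.1, hb x y hxy hx.2⟩

theorem top_mem_frBar (A : Set J) : (⊤ : FrBar J) ∈ frBar A := fun _ _ _ _ => trivial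

theorem compl_mem_frBar {A : Set J} {a : FrBar J} (ha : a ∈ frBar A) : aᶜ ∈ frBar A := by
  rw [mem_frBar, FrBar.coe_compl, Opens.coe_compl_eq_interior_compl]
  exact Cube.Saturated.interior_compl ha

theorem frBar_mono {A B : Set J} (h : A ⊆ B) : frBar A ⊆ frBar B :=
  fun _ ha x y hxy hx => ha x y (fun j hj => hxy j (h hj)) hx

theorem gen_mem_frBar (j : J) (n : ℕ) : gen j n ∈ frBar {j} := by
  intro x y hxy hx
  exact (hxy j rfl n).symm.trans hx

theorem toRegular_mem_frBar {A : Set J} {W : Opens (Cube J)} (hW : Cube.Saturated A W) :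
    Heyting.Regular.toRegular W ∈ frBar A := by
  rw [mem_frBar, Heyting.Regular.coe_toRegular, Opens.coe_compl_eq_interior_compl,
    Opens.coe_compl_eq_interior_compl]
  exact hW.interior_compl.interior_compl

/-- The smallest element of `FrBar(A)` above `a`. -/
def hull (A : Set J) (a : FrBar J) : FrBar J :=
  Heyting.Regular.toRegular
    ⟨Cube.saturation A (a : Opens (Cube J)), Cube.isOpen_saturation A (a : Opens (Cube J)).isOpen⟩

theorem hull_mem_frBar (A : Set J) (a : FrBar J) : hull A a ∈ frBar A :=
  toRegular_mem_frBar (Cube.saturation_saturated A _)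

theorem le_hull (A : Set J) (a : FrBar J) : a ≤ hull A a := by
  have h : (a : Opens (Cube J)) ≤
      ⟨Cube.saturation A (a : Opens (Cube J)),
        Cube.isOpen_saturation A (a : Opens (Cube J)).isOpen⟩ := Cube.subset_saturation A _
  exact h.trans (Heyting.Regular.gi.gc.le_u_l _)

theorem hull_le {A : Set J} {a b : FrBar J} (hb : b ∈ frBar A) (h : a ≤ b) : hull A a ≤ b := by
  refine Heyting.Regular.gi.gc.l_le ?_
  rintro x ⟨y, hy, hxy⟩
  exact hb y x (fun j hj n => (hxy j hj n).symm) (h hy)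

/-- If `b` misses `a`, then `bᶜ` is an element of `FrBar(A)` above `a`, hence above its hull. -/
theorem inf_ne_bot_of_inf_hull_ne_bot {A : Set J} {a b : FrBar J} (hb : b ∈ frBar A)
    (h : b ⊓ hull A a ≠ ⊥) : b ⊓ a ≠ ⊥ := by
  contrapose! h
  rw [← disjoint_iff, disjoint_comm, ← le_compl_iff_disjoint_right] at h ⊢
  exact hull_le (compl_mem_frBar hb) h

theorem ne_bot_iff {a : FrBar J} : a ≠ ⊥ ↔ ∃ x : Cube J, x ∈ (a : Opens (Cube J)) := by
  rw [← not_iff_not, not_not, not_exists, ← Heyting.Regular.coe_inj, FrBar.coe_bot]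
  rw [← SetLike.coe_set_eq, Opens.coe_bot, eq_empty_iff_forall_notMem]
  rfl

open Classical in
theorem inf_ne_bot_of_disjoint {A B : Set J} (hAB : Disjoint A B) {a b : FrBar J}
    (ha : a ∈ frBar A) (hb : b ∈ frBar B) (ha' : a ≠ ⊥) (hb' : b ≠ ⊥) : a ⊓ b ≠ ⊥ := by
  rw [ne_bot_iff] at ha' hb' ⊢
  obtain ⟨x, hx⟩ := ha'
  obtain ⟨y, hy⟩ := hb'
  refine ⟨fun i => if i.1 ∈ A then x i else y i, ha x _ (fun j hj n => by simp [hj]) hx,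
    hb y _ (fun j hj n => ?_) hy⟩
  have : j ∉ A := fun h => disjoint_left.1 hAB h hj
  simp [this]

/-- The element of the completion which prescribes the value `c` to the first `k` generators with
first index `j`. -/
def bits (j : J) (c : Bool) : ℕ → FrBar J
  | 0 => ⊤
  | k + 1 => bits j c k ⊓ bif c then gen j k else (gen j k)ᶜ

theorem bits_mem_frBar (j : J) (c : Bool) (k : ℕ) : bits j c k ∈ frBar {j} := by
  induction k with
  | zero => exact top_mem_frBar _
  | succ k ih =>
    refine inf_mem_frBar ih ?_
    cases c
    · exact compl_mem_frBar (gen_mem_frBar j k)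
    · exact gen_mem_frBar j k

theorem mem_gen_compl {j : J} {n : ℕ} {x : Cube J} :
    x ∈ ((gen j n)ᶜ : FrBar J).val ↔ x (j, n) = false := by
  rw [FrBar.coe_compl, ← SetLike.mem_coe, Opens.coe_compl_eq_interior_compl]
  have h : ((gen j n : FrBar J).val : Set (Cube J)) = {x | x (j, n) = true} := rfl
  rw [h, (Cube.isClopen_coord j n).compl.isOpen.interior_eq]
  simp

theorem const_mem_bits (j : J) (c : Bool) (k : ℕ) :
    (fun _ => c : Cube J) ∈ (bits j c k).val := by
  induction k with
  | zero => trivial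
  | succ k ih =>
    refine ⟨ih, ?_⟩
    cases c
    · exact mem_gen_compl.2 rfl
    · exact rfl

theorem bits_ne_bot (j : J) (c : Bool) (k : ℕ) : bits j c k ≠ ⊥ :=
  ne_bot_iff.2 ⟨_, const_mem_bits j c k⟩

/-! ### The countable chain condition -/

/-- Haar measure on the compact group `(ℤ/2)^(J × ℕ)` is finite, and positive on nonempty open sets.
-/
theorem Cube.countable_of_pairwiseDisjoint {𝒲 : Set (Set (Cube J))}
    (hd : 𝒲.PairwiseDisjoint id) (ho : ∀ W ∈ 𝒲, IsOpen W) (hn : ∀ W ∈ 𝒲, W.Nonempty) :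
    𝒲.Countable := by
  let G := J × ℕ → ZMod 2
  let e : G → Cube J := fun x i => decide (x i = 1)
  have he : Continuous e := continuous_pi fun i =>
    (continuous_of_discreteTopology (f := fun z : ZMod 2 => decide (z = 1))).comp
      (continuous_apply i)
  have hs : Function.Surjective e := fun y =>
    ⟨fun i => bif y i then 1 else 0, by ext i; cases h : y i <;> simp [e, h]⟩
  -- For uncountable `J` the product σ-algebra does not contain all open sets, so the Borel one is
  -- imposed.
  let _ : MeasurableSpace G := borel G
  have _ : BorelSpace G := ⟨rfl⟩
  let μ : MeasureTheory.Measure G := MeasureTheory.Measure.addHaar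
  have h := MeasureTheory.Measure.countable_meas_pos_of_disjoint_of_meas_iUnion_ne_top (ι := 𝒲) μ
    (As := fun W => e ⁻¹' W.1) (fun W => ((ho W W.2).preimage he).measurableSet)
    (fun V W hVW => (hd V.2 W.2 (fun h => hVW (Subtype.ext h))).preimage e)
    ((MeasureTheory.measure_lt_top_of_subset (subset_univ _)
      (isCompact_univ.measure_lt_top (μ := μ)).ne).ne)
  have h' : {W : 𝒲 | 0 < μ (e ⁻¹' W.1)} = univ := by
    refine eq_univ_of_forall fun W => ?_
    obtain ⟨y, hy⟩ := hn W W.2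
    obtain ⟨x, rfl⟩ := hs y
    exact ((ho W W.2).preimage he).measure_pos μ ⟨x, hy⟩
  rw [h', countable_univ_iff] at h
  exact h

theorem Cube.exists_finite_saturated {W : Set (Cube J)} (hW : IsOpen W) {x : Cube J} (hx : x ∈ W) :
    ∃ A : Set J, A.Finite ∧ ∃ V ⊆ W, IsOpen V ∧ Cube.Saturated A V ∧ x ∈ V := by
  obtain ⟨F, u, hu, hF⟩ := isOpen_pi_iff.1 hW x hx
  refine ⟨Prod.fst '' (F : Set (J × ℕ)), F.finite_toSet.image _, (F : Set (J × ℕ)).pi u, hF,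
    isOpen_set_pi F.finite_toSet fun i hi => (hu i hi).1, ?_, fun i hi => (hu i hi).2⟩
  intro y z hyz hy i hi
  have := hyz i.1 (mem_image_of_mem _ hi) i.2
  rw [Prod.mk.eta] at this
  rw [← this]
  exact hy i hi

/-- Every regular open subset of the Cantor cube depends on countably many coordinates. -/
theorem exists_countable_mem_frBar (a : FrBar J) : ∃ A : Set J, A.Countable ∧ a ∈ frBar A := by
  let C : Set (Set (Cube J)) := {V | V ⊆ (a.val : Set (Cube J)) ∧ IsOpen V ∧ V.Nonempty ∧
    ∃ A : Set J, A.Finite ∧ Cube.Saturated A V}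
  -- A maximal disjoint family of finitely determined open subsets of `a` is countable, and its
  -- union is dense in `a`, so it regularizes to `a`.
  obtain ⟨𝒲, h𝒲⟩ := zorn_subset {𝒲 : Set (Set (Cube J)) | 𝒲 ⊆ C ∧ 𝒲.PairwiseDisjoint id} (by
    intro c hc hchain
    refine ⟨⋃₀ c, ⟨sUnion_subset fun s hs => (hc hs).1, ?_⟩, fun s hs => subset_sUnion_of_mem hs⟩
    exact (pairwiseDisjoint_sUnion hchain.directedOn).2 fun s hs => (hc hs).2)
  have hC : ∀ V ∈ 𝒲, V ∈ C := fun V hV => h𝒲.prop.1 hV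
  have hcount : 𝒲.Countable := Cube.countable_of_pairwiseDisjoint h𝒲.prop.2
    (fun V hV => (hC V hV).2.1) fun V hV => (hC V hV).2.2.1
  choose! A hA using fun V hV => (hC V hV).2.2.2
  refine ⟨⋃ V ∈ 𝒲, A V, hcount.biUnion fun V hV => (hA V hV).1.countable, ?_⟩
  let D : Opens (Cube J) := ⟨⋃₀ 𝒲, isOpen_sUnion fun V hV => (hC V hV).2.1⟩
  have hD : Cube.Saturated (⋃ V ∈ 𝒲, A V) D := by
    rintro x y hxy ⟨V, hV, hx⟩
    exact ⟨V, hV, (hA V hV).2 x y (fun j hj n => hxy j (mem_biUnion hV hj) n) hx⟩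
  have ha : Heyting.Regular.toRegular D = a := by
    refine le_antisymm (Heyting.Regular.gi.gc.l_le ?_) ?_
    · rintro x ⟨V, hV, hx⟩
      exact (hC V hV).1 hx
    · rw [← sdiff_eq_bot_iff]
      by_contra hne
      obtain ⟨x, hx⟩ := ne_bot_iff.1 hne
      obtain ⟨B, hB, V, hV, hVo, hVB, hxV⟩ := Cube.exists_finite_saturated
        (a \ Heyting.Regular.toRegular D : FrBar J).val.isOpen hx
      have hVa : ∀ y ∈ V, y ∈ a.val := fun y hy => (hV hy).1
      have hVD : ∀ y ∈ V, y ∉ D := fun y hy hyD => by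
        have h1 : y ∈ ((Heyting.Regular.toRegular D)ᶜ : FrBar J).val := (hV hy).2
        have h2 : y ∈ (Heyting.Regular.toRegular D : FrBar J).val :=
          (Heyting.Regular.gi.gc.le_u_l D) hyD
        have h3 : y ∈ (Heyting.Regular.toRegular D ⊓ (Heyting.Regular.toRegular D)ᶜ : FrBar J).val :=
          ⟨h2, h1⟩
        rw [inf_compl_eq_bot] at h3
        exact h3
      have hVC : V ∈ C := ⟨hVa, hVo, ⟨x, hxV⟩, B, hB, hVB⟩
      have hmem := h𝒲.le_of_ge (y := insert V 𝒲) ⟨insert_subset hVC h𝒲.prop.1,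
        h𝒲.prop.2.insert fun W hW _ => disjoint_left.2 fun y hy hyW =>
          hVD y hy ⟨W, hW, hyW⟩⟩ (subset_insert V 𝒲) (mem_insert V 𝒲)
      exact hVD x hxV ⟨V, hmem, hxV⟩
  rw [← ha]
  exact toRegular_mem_frBar hD

/-! ### Points of Stone spaces -/

section StoneSpace

variable {B : Type v} [BooleanAlgebra B]

theorem StoneSpace.apply_inf_eq_true {t : StoneSpace B} {a b : B} :
    t (a ⊓ b) = true ↔ t a = true ∧ t b = true := by
  rw [map_inf t, Bool.min_eq_and, Bool.and_eq_true]

theorem StoneSpace.apply_compl_eq_true {t : StoneSpace B} {a : B} :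
    t aᶜ = true ↔ t a = false := by
  rw [map_compl']
  cases t a <;> decide

theorem StoneSpace.apply_top (t : StoneSpace B) : t ⊤ = true := map_top t

theorem StoneSpace.apply_mono {t : StoneSpace B} {a b : B} (h : a ≤ b) (ha : t a = true) :
    t b = true := by
  rw [← inf_eq_left.2 h, apply_inf_eq_true] at ha
  exact ha.2

theorem StoneSpace.ne_bot {t : StoneSpace B} {a : B} (h : t a = true) : a ≠ ⊥ := by
  rintro rfl
  simp at h

theorem StoneSpace.exists_apply_eq_true {b : B} (hb : b ≠ ⊥) : ∃ t : StoneSpace B, t b = true := by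
  classical
  obtain ⟨I, hI, -, hd⟩ := DistribLattice.prime_ideal_of_disjoint_filter_ideal
    (F := Order.PFilter.principal b) (I := Order.Ideal.principal (⊥ : B)) (by
      refine disjoint_left.2 fun x hx hx' => hb ?_
      have h1 : b ≤ x := hx
      have h2 : x ≤ ⊥ := hx'
      exact le_bot_iff.1 (h1.trans h2))
  have hbI : b ∉ I := disjoint_left.1 hd (show b ≤ b from le_rfl)
  have htop : (⊤ : B) ∉ I := fun h => hbI (I.lower le_top h)
  refine ⟨{ toFun := fun a => decide (a ∉ I)
            map_sup' := fun a c => ?_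
            map_inf' := fun a c => ?_
            map_top' := by simp [htop]
            map_bot' := by simp }, by simp [hbI]⟩
  · have : a ⊔ c ∈ I ↔ a ∈ I ∧ c ∈ I := Order.Ideal.sup_mem_iff
    by_cases ha : a ∈ I <;> by_cases hc : c ∈ I <;> simp [this, ha, hc]
  · have : a ⊓ c ∈ I ↔ a ∈ I ∨ c ∈ I :=
      ⟨hI.mem_or_mem, fun h => h.elim (I.lower inf_le_left) (I.lower inf_le_right)⟩
    by_cases ha : a ∈ I <;> by_cases hc : c ∈ I <;> simp [this, ha, hc]

theorem StoneSpace.isClopen (b : B) : IsClopen {t : StoneSpace B | t b = true} :=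
  (isClopen_discrete ({true} : Set Bool)).preimage (StoneSpace.continuous_eval b)

/-- A point of the Stone space may be modified outside a subalgebra `𝔅` so as to lie in all the
closed sets `P k`, if the latter are compatible with its trace on `𝔅`. -/
theorem StoneSpace.exists_extension {𝔅 : Set B} (htop : ⊤ ∈ 𝔅)
    (hinf : ∀ a ∈ 𝔅, ∀ b ∈ 𝔅, a ⊓ b ∈ 𝔅) (hcompl : ∀ a ∈ 𝔅, aᶜ ∈ 𝔅) (s : StoneSpace B)
    {P : ℕ → Set (StoneSpace B)} (hP : Antitone P) (hc : ∀ k, IsClosed (P k))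
    (h : ∀ a ∈ 𝔅, s a = true → ∀ k, ∃ t ∈ P k, t a = true) :
    ∃ t : StoneSpace B, (∀ k, t ∈ P k) ∧ ∀ a ∈ 𝔅, t a = s a := by
  let ι := {a : B // a ∈ 𝔅 ∧ s a = true} × ℕ
  have : Nonempty ι := ⟨⟨⟨⊤, htop, apply_top s⟩, 0⟩⟩
  let D : ι → Set (StoneSpace B) := fun i => P i.2 ∩ {t | t i.1.1 = true}
  have hD : ∀ i, IsClosed (D i) := fun i => (hc i.2).inter (isClopen i.1.1).isClosed
  obtain ⟨t, ht⟩ := IsCompact.nonempty_iInter_of_directed_nonempty_isCompact_isClosed D (by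
      rintro ⟨⟨a, ha, has⟩, k⟩ ⟨⟨b, hb, hbs⟩, l⟩
      refine ⟨⟨⟨a ⊓ b, hinf a ha b hb, apply_inf_eq_true.2 ⟨has, hbs⟩⟩, max k l⟩, ?_, ?_⟩
      · exact fun t ht => ⟨hP (le_max_left k l) ht.1, (apply_inf_eq_true.1 ht.2).1⟩
      · exact fun t ht => ⟨hP (le_max_right k l) ht.1, (apply_inf_eq_true.1 ht.2).2⟩)
    (fun i => h i.1.1 i.1.2.1 i.1.2.2 i.2) (fun i => (hD i).isCompact) hD
  rw [mem_iInter] at ht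
  refine ⟨t, fun k => (ht ⟨⟨⊤, htop, apply_top s⟩, k⟩).1, fun a ha => ?_⟩
  cases hs : s a
  · exact apply_compl_eq_true.1 (ht ⟨⟨aᶜ, hcompl a ha, apply_compl_eq_true.2 hs⟩, 0⟩).2
  · exact (ht ⟨⟨a, ha, hs⟩, 0⟩).2

theorem StoneSpace.exists_of_isOpen {U : Set (StoneSpace B)} (hU : IsOpen U) {t : StoneSpace B}
    (ht : t ∈ U) : ∃ b : B, t b = true ∧ ∀ s : StoneSpace B, s b = true → s ∈ U := by
  by_contra! h
  obtain ⟨s, hs, hst⟩ := exists_extension (𝔅 := (univ : Set B)) trivial (fun _ _ _ _ => trivial)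
    (fun _ _ => trivial) t (P := fun _ => Uᶜ) antitone_const (fun _ => hU.isClosed_compl)
    fun a _ ha _ => by
      obtain ⟨s, hs, hsU⟩ := h a ha
      exact ⟨s, hsU, hs⟩
  have : s = t := DFunLike.ext _ _ fun a => hst a trivial
  exact hs 0 (this ▸ ht)

end StoneSpace

/-! ### Functions depending on a set of coordinates -/

theorem DependsOn.eq {f : C(L J, ℝ)} {A : Set J} (hf : DependsOn f A) {s t : L J}
    (h : ∀ a ∈ frBar A, s a = t a) : f s = f t :=
  hf s t (funext fun a => h a.1 a.2)

theorem DependsOn.mono {f : C(L J, ℝ)} {A B : Set J} (hf : DependsOn f A) (h : A ⊆ B) :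
    DependsOn f B :=
  fun _ _ hst => hf.eq fun a ha => congrFun hst ⟨a, frBar_mono h ha⟩

theorem DependsOn.mul {f g : C(L J, ℝ)} {A : Set J} (hf : DependsOn f A) (hg : DependsOn g A) :
    DependsOn (f * g) A := fun s t h => by
  rw [ContinuousMap.mul_apply, ContinuousMap.mul_apply, hf s t h, hg s t h]

theorem exists_extension_frBar (A : Set J) (s : L J) {P : Set (L J)} (hc : IsClosed P)
    (h : ∀ a ∈ frBar A, s a = true → ∃ t ∈ P, t a = true) :
    ∃ t ∈ P, ∀ a ∈ frBar A, t a = s a := by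
  obtain ⟨t, ht, hts⟩ := StoneSpace.exists_extension (top_mem_frBar A)
    (fun a ha b hb => inf_mem_frBar ha hb) (fun a ha => compl_mem_frBar ha) s
    (P := fun _ => P) antitone_const (fun _ => hc) fun a ha hs _ => h a ha hs
  exact ⟨t, ht 0, hts⟩

/-- Otherwise compactness yields a point with the same trace as `p` on `FrBar(A)` but a different
value of `f`. -/
theorem DependsOn.exists_mem_frBar {f : C(L J, ℝ)} {A : Set J} (hf : DependsOn f A) (p : L J)
    {ε : ℝ} (hε : 0 < ε) :
    ∃ a ∈ frBar A, p a = true ∧ ∀ q : L J, q a = true → |f q - f p| < ε := by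
  by_contra! h
  obtain ⟨t, ht, htp⟩ := exists_extension_frBar A p (P := {q | ε ≤ |f q - f p|})
    (isClosed_le continuous_const (by fun_prop)) fun a ha hp => by
      obtain ⟨q, hq, hqε⟩ := h a ha hp
      exact ⟨q, hqε, hq⟩
  have h1 : ε ≤ |f t - f p| := ht
  rw [hf.eq htp, sub_self, abs_zero] at h1
  exact absurd h1 (not_le.2 hε)

/-- The image of `[v]` under `p_A` is exactly the clopen set given by the hull of `v`. -/
theorem exists_of_apply_hull {A : Set J} {v : FrBar J} {t : L J} (h : t (hull A v) = true) :
    ∃ y : L J, y v = true ∧ ∀ a ∈ frBar A, y a = t a :=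
  exists_extension_frBar A t (StoneSpace.isClopen v).isClosed fun a ha hta => by
    obtain ⟨y, hy⟩ := StoneSpace.exists_apply_eq_true (inf_ne_bot_of_inf_hull_ne_bot ha
      (StoneSpace.ne_bot (StoneSpace.apply_inf_eq_true.2 ⟨hta, h⟩)))
    exact ⟨y, (StoneSpace.apply_inf_eq_true.1 hy).2, (StoneSpace.apply_inf_eq_true.1 hy).1⟩

/-! ### Suprema in `C(L)` -/

/-- Suprema in `C(L)` are not pointwise, but an upper bound can be truncated at `r` on the clopen
set `[v]` and remain continuous. -/
theorem le_of_isLUB {B : Type v} [BooleanAlgebra B] {H : Set C(StoneSpace B, ℝ)}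
    {g : C(StoneSpace B, ℝ)} (hg : IsLUB H g) {v : B} {r : ℝ}
    (h : ∀ f ∈ H, ∀ t : StoneSpace B, t v = true → f t ≤ r) {t : StoneSpace B} (ht : t v = true) :
    g t ≤ r := by
  let χ : C(StoneSpace B, ℝ) := ⟨fun t => bif t v then 1 else 0,
    (continuous_of_discreteTopology (f := fun b : Bool => (bif b then 1 else 0 : ℝ))).comp
      (StoneSpace.continuous_eval v)⟩
  let g' : C(StoneSpace B, ℝ) := ⟨fun t => g t - χ t * max (g t - r) 0, by fun_prop⟩
  have h1 : g ≤ g' := hg.2 fun f hf s => by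
    change f s ≤ g s - (bif s v then 1 else 0) * max (g s - r) 0
    have h2 : f s ≤ g s := hg.1 hf s
    cases hs : s v
    · simpa using h2
    · have := h f hf s hs
      rcases le_total (g s - r) 0 with h3 | h3
      · simpa [max_eq_right h3] using h2
      · simpa [max_eq_left h3] using this
  have h4 : g t ≤ g t - (bif t v then 1 else 0) * max (g t - r) 0 := h1 t
  rw [ht, cond_true, one_mul] at h4
  have := le_max_left (g t - r) 0
  linarith

/-- A bound `g < r` on `[v]` bounds all members of `H` on the hull of `v`, since they depend on `A`.
So it bounds `g` there too, and the hull does not separate points with the same trace. -/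
theorem dependsOn_of_isLUB {H : Set C(L J, ℝ)} {g : C(L J, ℝ)} (hg : IsLUB H g) {A : Set J}
    (hH : ∀ f ∈ H, DependsOn f A) : DependsOn g A := by
  have key : ∀ p q : L J, (∀ a ∈ frBar A, p a = q a) → g q ≤ g p := by
    intro p q hpq
    by_contra! hlt
    obtain ⟨r, hpr, hrq⟩ := exists_between hlt
    obtain ⟨v, hpv, hv⟩ := StoneSpace.exists_of_isOpen
      (isOpen_lt g.continuous continuous_const : IsOpen {t | g t < r}) hpr
    refine not_le.2 hrq (le_of_isLUB hg (v := hull A v) (fun f hf t ht => ?_) ?_)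
    · obtain ⟨y, hy, hyt⟩ := exists_of_apply_hull ht
      rw [← (hH f hf).eq hyt]
      exact (hg.1 hf y).trans (hv y hy).le
    · rw [← hpq _ (hull_mem_frBar A v)]
      exact StoneSpace.apply_mono (le_hull A v) hpv
  intro s t hst
  have hst' : ∀ a ∈ frBar A, s a = t a := fun a ha => congrFun hst ⟨a, ha⟩
  exact le_antisymm (key t s fun a ha => (hst' a ha).symm) (key s t hst')

/-! ### Values of the functions `d` -/

/-- The real number in `[0,1]` with the binary digits `b`. -/
def binary (b : ℕ → Bool) : ℝ := ∑' n : ℕ, (if b n = true then (1 : ℝ) else 0) / 2 ^ (n + 1)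

theorem d_apply (j : J) (t : L J) : d j t = binary fun n => t (gen j n) := rfl

theorem summable_binary (b : ℕ → Bool) :
    Summable fun n : ℕ => (if b n = true then (1 : ℝ) else 0) / 2 ^ (n + 1) := by
  refine Summable.of_nonneg_of_le (fun n => by positivity) (fun n => ?_)
    ((summable_nat_add_iff 1).2 summable_geometric_two)
  rw [one_div, inv_pow, div_eq_mul_inv]
  refine mul_le_of_le_one_left (by positivity) ?_
  split_ifs <;> simp

theorem binary_nonneg (b : ℕ → Bool) : 0 ≤ binary b := tsum_nonneg fun n => by positivity

theorem binary_add_not (b : ℕ → Bool) : (binary b + binary fun n => !b n) = 1 := by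
  rw [binary, binary, ← (summable_binary b).tsum_add (summable_binary _)]
  refine Eq.trans ?_ (tsum_geometric_two' 1)
  congr 1
  ext n
  cases b n <;> simp [pow_succ, div_eq_mul_inv, mul_comm]

theorem binary_le_one (b : ℕ → Bool) : binary b ≤ 1 := by
  have := binary_nonneg fun n => !b n
  linarith [binary_add_not b]

theorem binary_le {b : ℕ → Bool} {k : ℕ} (h : ∀ i < k, b i = false) : binary b ≤ (1 / 2) ^ k := by
  have h1 : binary b = (1 / 2) ^ k * binary fun n => b (n + k) := by
    rw [binary, ← (summable_binary b).sum_add_tsum_nat_add k, Finset.sum_eq_zero, zero_add, binary,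
      ← tsum_mul_left]
    · congr 1
      ext n
      rw [div_pow, one_pow, one_div_mul_eq_div, div_div, ← pow_add, add_right_comm]
    · intro i hi
      simp [h i (Finset.mem_range.1 hi)]
  rw [h1]
  exact mul_le_of_le_one_right (by positivity) (binary_le_one _)

theorem apply_bits {t : L J} {j : J} {c : Bool} {k : ℕ} (h : t (bits j c k) = true) :
    ∀ i < k, t (gen j i) = c := by
  induction k with
  | zero => intro i hi; omega
  | succ k ih =>
    rw [bits, StoneSpace.apply_inf_eq_true] at h
    intro i hi
    rcases Nat.lt_succ_iff_lt_or_eq.1 hi with hi | rfl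
    · exact ih h.1 i hi
    · cases c
      · exact StoneSpace.apply_compl_eq_true.1 h.2
      · exact h.2

theorem isClosed_bits (δ : J) (c : Bool) (k : ℕ) : IsClosed {t : L J | t (bits δ c k) = true} :=
  (StoneSpace.isClopen _).isClosed

theorem antitone_bits (δ : J) (c : Bool) : Antitone fun k => {t : L J | t (bits δ c k) = true} :=
  antitone_nat_of_succ_le fun _ _ ht => (StoneSpace.apply_inf_eq_true.1 ht).1

theorem apply_gen_of_forall_bits {t : L J} {δ : J} {c : Bool}
    (h : ∀ k, t (bits δ c k) = true) (n : ℕ) : t (gen δ n) = c :=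
  apply_bits (h (n + 1)) n n.lt_succ_self

theorem d_eq_of_forall {t : L J} {j : J} {c : Bool} (h : ∀ n, t (gen j n) = c) :
    d j t = bif c then 1 else 0 := by
  rw [d_apply, funext h]
  cases c
  · simp [binary]
  · have := binary_add_not fun _ => true
    simpa [binary] using this

theorem dSigned_apply (ν : ℤˣ) (j : J) (t : L J) :
    dSigned ν j t = if ν = 1 then d j t else 1 - d j t := by
  unfold dSigned
  split_ifs <;> simp

theorem dSigned_nonneg (ν : ℤˣ) (j : J) (t : L J) : 0 ≤ dSigned ν j t := by
  rw [dSigned_apply, d_apply]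
  split_ifs
  · exact binary_nonneg _
  · linarith [binary_le_one fun n => t (gen j n)]

theorem dSigned_le_one (ν : ℤˣ) (j : J) (t : L J) : dSigned ν j t ≤ 1 := by
  rw [dSigned_apply, d_apply]
  split_ifs
  · exact binary_le_one _
  · linarith [binary_nonneg fun n => t (gen j n)]

theorem dSigned_le {ν : ℤˣ} {j : J} {t : L J} {k : ℕ}
    (h : t (bits j (decide (ν ≠ 1)) k) = true) : dSigned ν j t ≤ (1 / 2) ^ k := by
  have h1 := apply_bits h
  rw [dSigned_apply, d_apply]
  split_ifs with hν
  · exact binary_le fun i hi => by rw [h1 i hi]; simp [hν]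
  · have h2 := binary_le (b := fun n => !t (gen j n)) (k := k)
      fun i hi => by rw [h1 i hi]; simp [hν]
    linarith [binary_add_not fun n => t (gen j n)]

theorem dependsOn_d (j : J) : DependsOn (d j) {j} := fun s t h => by
  rw [d_apply, d_apply]
  congr 1
  ext n
  exact congrFun h ⟨gen j n, gen_mem_frBar j n⟩

theorem dependsOn_dSigned (ν : ℤˣ) (j : J) : DependsOn (dSigned ν j) {j} := fun s t h => by
  rw [dSigned_apply, dSigned_apply, dependsOn_d j s t h]

end Cube

/-! ### Suprema of disjoint sequences -/

section Disjoint

variable {J : Type u} {f e : ℕ → C(L J, ℝ)} {M : Set ℕ} {g : C(L J, ℝ)}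

theorem nonneg_of_isLUB_disjoint (hg : IsLUB ((fun n => f n * e n) '' M) g) {n : ℕ} (hn : n ∈ M)
    {s : L J} (hs : f n s = 0) : 0 ≤ g s := by
  have h : (f n * e n) s ≤ g s := hg.1 (mem_image_of_mem _ hn) s
  rwa [ContinuousMap.mul_apply, hs, zero_mul] at h

open Classical in
-- Near `s` all terms other than the `n`th vanish, so the supremum can be computed locally. The `0`
-- in the maximum comes from another index in the infinite set `M`.
theorem eq_of_isLUB_disjoint (hg : IsLUB ((fun n => f n * e n) '' M) g) (hM : M.Infinite)
    (hf : ∀ m n, m ≠ n → f m * f n = 0) {n : ℕ} {s : L J} (hs : f n s ≠ 0) :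
    g s = if n ∈ M then max (f n s * e n s) 0 else 0 := by
  have hzero : ∀ t : L J, f n t ≠ 0 → ∀ m, m ≠ n → f m t = 0 := fun t ht m hm =>
    (mul_eq_zero.1 (DFunLike.congr_fun (hf m n hm) t)).resolve_right ht
  refine le_antisymm ?_ ?_
  · refine le_of_forall_pos_le_add fun ε hε => ?_
    obtain ⟨v, hsv, hv⟩ := StoneSpace.exists_of_isOpen
      (((isOpen_ne_fun (f n).continuous continuous_const).inter
        (isOpen_lt (f n * e n).continuous continuous_const)) :
        IsOpen ({t | f n t ≠ 0} ∩ {t | (f n * e n) t < (f n * e n) s + ε}))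
      ⟨hs, lt_add_of_pos_right _ hε⟩
    refine le_of_isLUB hg (v := v) ?_ hsv
    rintro _ ⟨m, hm, rfl⟩ t ht
    obtain ⟨h1, h2⟩ := hv t ht
    by_cases hmn : m = n
    · subst hmn
      rw [if_pos hm]
      exact (show (f m * e m) t ≤ f m s * e m s + ε from le_of_lt h2).trans (by
        gcongr
        exact le_max_left _ _)
    · have h3 : (f m * e m) t = 0 := by
        rw [ContinuousMap.mul_apply, hzero t h1 m hmn, zero_mul]
      refine h3.le.trans (add_nonneg ?_ hε.le)
      split_ifs
      · exact le_max_right _ _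
      · exact le_rfl
  · obtain ⟨m, hm, hmn⟩ := hM.exists_notMem_finset {n}
    have h0 := nonneg_of_isLUB_disjoint hg hm (hzero s hs m (by simpa using hmn))
    split_ifs with hn
    · exact max_le (hg.1 (mem_image_of_mem _ hn) s) h0
    · exact h0

theorem apply_eq_apply_of_isLUB_disjoint (hg : IsLUB ((fun n => f n * e n) '' M) g)
    (hM : M.Infinite) (hf : ∀ m n, m ≠ n → f m * f n = 0) {s t : L J}
    (hfst : ∀ n, f n s = f n t) (hest : ∀ n, e n s = e n t)
    (hs : (∀ n, f n s = 0) → g s = 0) (ht : (∀ n, f n t = 0) → g t = 0) : g s = g t := by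
  classical
  by_cases h : ∀ n, f n s = 0
  · rw [hs h, ht fun n => (hfst n).symm.trans (h n)]
  · obtain ⟨n, hn⟩ := not_forall.1 h
    rw [eq_of_isLUB_disjoint hg hM hf hn, eq_of_isLUB_disjoint hg hM hf (hfst n ▸ hn), hfst, hest]

end Disjoint

/-! ### Making the added functions vanish -/

section Extension

variable {J : Type u} [LinearOrder J]

theorem exists_le_of_ladder {f : ℕ → C(L J, ℝ)} {ν : ℕ → ℤˣ} {η : ℕ → J} {M : Set ℕ}
    {g : C(L J, ℝ)} (hg : IsLUB ((fun n => f n * dSigned (ν n) (η n)) '' M) g)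
    (hf : ∀ m n, m ≠ n → f m * f n = 0) {β δ : J} (hβ : β < δ)
    (hfβ : ∀ n, DependsOn (f n) (Iio β)) (hηδ : ∀ n, η n < δ)
    (hη : ∀ γ < δ, ∀ᶠ n in atTop, γ < η n) {s : L J} (hs : ∀ n, f n s = 0) {γ : J} (hγ : γ < δ)
    {a : FrBar J} (ha : a ∈ frBar (Iic γ)) (has : s a = true) {ε : ℝ} (hε : 0 < ε) :
    ∃ b ∈ frBar (Iio δ), b ≤ a ∧ b ≠ ⊥ ∧ ∀ t : L J, t b = true → g t ≤ ε := by
  set μ := max γ β with hμ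
  -- Both `a` and all the `f n` live on coordinates up to `μ`, while from `N` on the digits of `η n`
  -- are independent of these.
  have hμδ : μ < δ := max_lt hγ hβ
  have hβμ : Iio β ⊆ Iic μ := fun x hx => (le_of_lt hx).trans (le_max_right γ β)
  obtain ⟨N, hN⟩ := eventually_atTop.1 (hη μ hμδ)
  have small : ∀ k : ℕ, ∃ b ∈ frBar (Iic μ), b ≤ a ∧ s b = true ∧
      ∀ n < k, ∀ t : L J, t b = true → |f n t| < ε := by
    intro k
    induction k with
    | zero => exact ⟨a, frBar_mono (Iic_subset_Iic.2 (le_max_left γ β)) ha, le_rfl, has, by simp⟩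
    | succ k ih =>
      obtain ⟨b, hb, hba, hsb, hbf⟩ := ih
      obtain ⟨u, hu, hsu, huf⟩ := (hfβ k).exists_mem_frBar s hε
      refine ⟨b ⊓ u, inf_mem_frBar hb (frBar_mono hβμ hu), inf_le_left.trans hba,
        StoneSpace.apply_inf_eq_true.2 ⟨hsb, hsu⟩, fun n hn t ht => ?_⟩
      rw [StoneSpace.apply_inf_eq_true] at ht
      rcases Nat.lt_succ_iff_lt_or_eq.1 hn with hn | rfl
      · exact hbf n hn t ht.1
      · simpa [hs] using huf t ht.2
  obtain ⟨b, hb, hba, hsb, hbf⟩ := small N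
  -- If some late `f n` is nonzero somewhere on `[b]`, move there: disjointness kills the other
  -- terms and the digits of `η n` shrink this one. Otherwise only the terms before `N` survive on
  -- `[b]`, and they are already small.
  by_cases hcase : ∃ n, N ≤ n ∧ ∃ p : L J, p b = true ∧ f n p ≠ 0
  · obtain ⟨n, hNn, p, hpb, hp⟩ := hcase
    -- Radius `|f n p|` keeps `f n` nonzero on `[u]` and bounds it by `2 * |f n p|`.
    obtain ⟨u, hu, hpu, huf⟩ := (hfβ n).exists_mem_frBar p (abs_pos.2 hp)
    obtain ⟨k, hk⟩ : ∃ k : ℕ, 2 * |f n p| * (1 / 2) ^ k < ε := by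
      have h := (tendsto_pow_atTop_nhds_zero_of_lt_one (r := (1 / 2 : ℝ)) (by norm_num)
        (by norm_num)).const_mul (2 * |f n p|)
      rw [mul_zero] at h
      exact (h.eventually_lt_const hε).exists
    -- Digits `0` make `d` small, digits `1` make `1 - d` small.
    set w := bits (η n) (decide (ν n ≠ 1)) k
    have hw : w ∈ frBar {η n} := bits_mem_frBar _ _ _
    have hbu : b ⊓ u ∈ frBar (Iic μ) := inf_mem_frBar hb (frBar_mono hβμ hu)
    refine ⟨b ⊓ u ⊓ w, inf_mem_frBar (frBar_mono (fun x hx => lt_of_le_of_lt hx hμδ) hbu)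
      (frBar_mono (singleton_subset_iff.2 (mem_Iio.2 (hηδ n))) hw), inf_le_left.trans (inf_le_left.trans hba),
      inf_ne_bot_of_disjoint ?_ hbu hw ?_ (bits_ne_bot _ _ _), fun t ht => ?_⟩
    · rw [disjoint_singleton_right]
      exact not_le.2 (hN n hNn)
    · exact StoneSpace.ne_bot (StoneSpace.apply_inf_eq_true.2 ⟨hpb, hpu⟩)
    · refine le_of_isLUB hg ?_ ht
      rintro _ ⟨m, -, rfl⟩ t ht
      simp only [StoneSpace.apply_inf_eq_true] at ht
      obtain ⟨⟨-, htu⟩, htw⟩ := ht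
      have h1 := huf t htu
      simp only [ContinuousMap.mul_apply]
      by_cases hmn : m = n
      · subst hmn
        have h2 : f m t ≤ 2 * |f m p| := by
          have := (abs_lt.1 h1).2
          linarith [le_abs_self (f m p)]
        calc f m t * dSigned (ν m) (η m) t ≤ 2 * |f m p| * dSigned (ν m) (η m) t :=
              mul_le_mul_of_nonneg_right h2 (dSigned_nonneg _ _ _)
          _ ≤ 2 * |f m p| * (1 / 2) ^ k :=
              mul_le_mul_of_nonneg_left (dSigned_le htw) (by positivity)
          _ ≤ ε := hk.le
      · have h2 : f n t ≠ 0 := fun h0 => by simp [h0] at h1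
        have h3 : f m t * f n t = 0 := DFunLike.congr_fun (hf m n hmn) t
        rw [(mul_eq_zero.1 h3).resolve_right h2, zero_mul]
        exact hε.le
  · push Not at hcase
    refine ⟨b, frBar_mono (fun x hx => lt_of_le_of_lt hx hμδ) hb, hba, StoneSpace.ne_bot hsb,
      fun t ht => le_of_isLUB hg ?_ ht⟩
    rintro _ ⟨m, -, rfl⟩ t ht
    rw [ContinuousMap.mul_apply]
    rcases lt_or_ge m N with hm | hm
    · calc f m t * dSigned (ν m) (η m) t ≤ |f m t| * dSigned (ν m) (η m) t :=
            mul_le_mul_of_nonneg_right (le_abs_self _) (dSigned_nonneg _ _ _)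
        _ ≤ |f m t| * 1 := mul_le_mul_of_nonneg_left (dSigned_le_one _ _ _) (abs_nonneg _)
        _ ≤ ε := by rw [mul_one]; exact (hbf m hm t ht).le
    · rw [hcase m hm t ht, zero_mul]
      exact hε.le

theorem exists_apply_inf_bits {δ : J} {b : FrBar J} (hb : b ∈ frBar (Iio δ)) (hb' : b ≠ ⊥)
    (c : Bool) (k : ℕ) : ∃ t : L J, t b = true ∧ t (bits δ c k) = true := by
  obtain ⟨t, ht⟩ := StoneSpace.exists_apply_eq_true (inf_ne_bot_of_disjoint
    (disjoint_singleton_right.2 self_notMem_Iio) hb (bits_mem_frBar δ c k) hb' (bits_ne_bot δ c k))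
  exact ⟨t, StoneSpace.apply_inf_eq_true.1 ht⟩

theorem exists_extension_gen (s : L J) (δ : J) (c : Bool) :
    ∃ t : L J, (∀ a ∈ frBar (Iio δ), t a = s a) ∧ ∀ n, t (gen δ n) = c := by
  obtain ⟨t, ht, hts⟩ := StoneSpace.exists_extension (top_mem_frBar (Iio δ))
    (fun a ha b hb => inf_mem_frBar ha hb) (fun a ha => compl_mem_frBar ha) s
    (antitone_bits δ c) (isClosed_bits δ c) fun a ha hs k => by
      obtain ⟨t, hta, htk⟩ := exists_apply_inf_bits ha (StoneSpace.ne_bot hs) c k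
      exact ⟨t, htk, hta⟩
  exact ⟨t, hts, apply_gen_of_forall_bits ht⟩

theorem exists_extension_ladder {f : ℕ → C(L J, ℝ)} {ν : ℕ → ℤˣ} {η : ℕ → J} {M : Set ℕ}
    {g : C(L J, ℝ)} (hg : IsLUB ((fun n => f n * dSigned (ν n) (η n)) '' M) g)
    (hf : ∀ m n, m ≠ n → f m * f n = 0) {β δ : J} (hβ : β < δ)
    (hfβ : ∀ n, DependsOn (f n) (Iio β)) (hηδ : ∀ n, η n < δ)
    (hη : ∀ γ < δ, ∀ᶠ n in atTop, γ < η n) {s : L J} (hs : ∀ n, f n s = 0) (c : Bool) :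
    ∃ t : L J, (∀ γ < δ, ∀ a ∈ frBar (Iic γ), t a = s a) ∧ (∀ n, t (gen δ n) = c) ∧ g t ≤ 0 := by
  have hP : Antitone fun k : ℕ => {t : L J | t (bits δ c k) = true} ∩ {t | g t ≤ (1 / 2) ^ k} :=
    fun k l hkl => inter_subset_inter (antitone_bits δ c hkl) fun t ht =>
      le_trans (show g t ≤ _ from ht) (pow_le_pow_of_le_one (by norm_num) (by norm_num) hkl)
  -- The trace is kept only on the union of the `FrBar(Iic γ)`, `γ < δ`. Keeping it on all of
  -- `FrBar(Iio δ)` would already fix the value of `g`.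
  obtain ⟨t, ht, hts⟩ := StoneSpace.exists_extension
    (𝔅 := {a : FrBar J | ∃ γ < δ, a ∈ frBar (Iic γ)}) ⟨β, hβ, top_mem_frBar _⟩
    (fun a ⟨γ, hγ, ha⟩ b ⟨γ', hγ', hb⟩ => ⟨max γ γ', max_lt hγ hγ', inf_mem_frBar
      (frBar_mono (Iic_subset_Iic.2 (le_max_left _ _)) ha)
      (frBar_mono (Iic_subset_Iic.2 (le_max_right _ _)) hb)⟩)
    (fun a ⟨γ, hγ, ha⟩ => ⟨γ, hγ, compl_mem_frBar ha⟩) s hP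
    (fun k => (isClosed_bits δ c k).inter (isClosed_le g.continuous continuous_const))
    (fun a ⟨γ, hγ, ha⟩ has k => by
      obtain ⟨b, hb, hba, hb', hbg⟩ := exists_le_of_ladder hg hf hβ hfβ hηδ hη hs hγ ha has
        (show (0 : ℝ) < (1 / 2) ^ k by positivity)
      obtain ⟨t, htb, htk⟩ := exists_apply_inf_bits hb hb' c k
      exact ⟨t, ⟨htk, hbg t htb⟩, StoneSpace.apply_mono hba htb⟩)
  exact ⟨t, fun γ hγ a ha => hts a ⟨γ, hγ, ha⟩, apply_gen_of_forall_bits fun k => (ht k).1,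
    ge_of_tendsto' (tendsto_pow_atTop_nhds_zero_of_lt_one (by norm_num) (by norm_num))
      fun k => (ht k).2⟩

end Extension

/-! ### Points with prescribed behaviour -/

section Points

variable {l : Ordinal.{u}} {𝓕 : Set C(L (Iio l), ℝ)} {S : Set (Iio l)}
  {ν : Iio l → ℕ → ℤˣ} {η : Iio l → ℕ → Iio l} {f : Iio l → ℕ → C(L (Iio l), ℝ)}
  {β : Iio l → Iio l} {M : Iio l → Set ℕ} {g : Iio l → C(L (Iio l), ℝ)}

theorem IsLadderFamilyWith.eventually_lt (h : IsLadderFamilyWith 𝓕 S ν η f β M g) {δ : Iio l}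
    (hδ : δ ∈ S) {γ : Iio l} (hγ : γ < δ) : ∀ᶠ n in atTop, γ < η δ n :=
  (h.eta_tendsto δ hδ).eventually (Ioi_mem_nhds (show (γ : Ordinal.{u}) < δ from hγ))

theorem IsLadderFamilyWith.dependsOn_g (h : IsLadderFamilyWith 𝓕 S ν η f β M g) {δ : Iio l}
    (hδ : δ ∈ S) : DependsOn (g δ) (Iio δ) := by
  refine dependsOn_of_isLUB (h.isLUB_g δ hδ) ?_
  rintro _ ⟨n, -, rfl⟩
  exact ((h.f_dependsOn δ hδ n).mono (Iio_subset_Iio (h.beta_lt δ hδ).le)).mul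
    ((dependsOn_dSigned _ _).mono (singleton_subset_iff.2 (h.eta_lt δ hδ n)))

/-- The point `s` has all the digits of index `γ` equal to `c`, and the added function `g γ`
vanishes at `s` if all the functions `f γ n` do. -/
def IsNeutralAt (S : Set (Iio l)) (f : Iio l → ℕ → C(L (Iio l), ℝ)) (g : Iio l → C(L (Iio l), ℝ))
    (c : Bool) (s : L (Iio l)) (γ : Iio l) : Prop :=
  (∀ n, s (gen γ n) = c) ∧ (γ ∈ S → (∀ n, f γ n s = 0) → g γ s = 0)

theorem IsNeutralAt.congr (h : IsLadderFamilyWith 𝓕 S ν η f β M g) {c : Bool} {s t : L (Iio l)}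
    {γ : Iio l} (hs : IsNeutralAt S f g c s γ) (hst : ∀ a ∈ frBar (Iic γ), s a = t a) :
    IsNeutralAt S f g c t γ := by
  refine ⟨fun n => ?_, fun hγ hf => ?_⟩
  · rw [← hst _ (frBar_mono (singleton_subset_iff.2 (mem_Iic.2 le_rfl)) (gen_mem_frBar γ n)), hs.1]
  · rw [← ((h.dependsOn_g hγ).mono Iio_subset_Iic_self).eq hst]
    refine hs.2 hγ fun n => ?_
    rw [← hf n]
    exact ((h.f_dependsOn γ hγ n).mono
      (Iio_subset_Iic_self.trans (Iic_subset_Iic.2 (h.beta_lt γ hγ).le))).eq hst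

theorem exists_isNeutralAt (h : IsLadderFamilyWith 𝓕 S ν η f β M g) (c : Bool) (s : L (Iio l))
    (δ : Iio l) : ∃ t : L (Iio l), (∀ γ < δ, ∀ a ∈ frBar (Iic γ), t a = s a) ∧
      IsNeutralAt S f g c t δ := by
  by_cases hδ : δ ∈ S ∧ ∀ n, f δ n s = 0
  · obtain ⟨t, hts, htc, htg⟩ := exists_extension_ladder (h.isLUB_g δ hδ.1)
      (h.f_disjoint δ hδ.1) (h.beta_lt δ hδ.1) (h.f_dependsOn δ hδ.1) (h.eta_lt δ hδ.1)
      (fun γ hγ => h.eventually_lt hδ.1 hγ) hδ.2 c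
    refine ⟨t, hts, htc, fun _ hf => le_antisymm htg ?_⟩
    obtain ⟨n, hn⟩ := (h.infinite_M δ hδ.1).nonempty
    exact nonneg_of_isLUB_disjoint (h.isLUB_g δ hδ.1) hn (hf n)
  · obtain ⟨t, hts, htc⟩ := exists_extension_gen s δ c
    refine ⟨t, fun γ hγ a ha => hts a (frBar_mono (fun x hx => lt_of_le_of_lt hx hγ) ha), htc,
      fun hS hf => (hδ ⟨hS, fun n => ?_⟩).elim⟩
    rw [← hf n]
    exact ((h.f_dependsOn δ hS n).mono (Iio_subset_Iio (h.beta_lt δ hS).le)).eq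
      fun a ha => (hts a ha).symm

/-- Transfinite recursion in the form of Zorn's lemma: an approximation is a point that is neutral
on an initial segment beyond `α`. Chains are bounded by compactness, and the first missing index is
added by `exists_isNeutralAt`. -/
theorem exists_isNeutralAt_of_gt (h : IsLadderFamilyWith 𝓕 S ν η f β M g) (c : Bool)
    (s : L (Iio l)) (α : Iio l) : ∃ t : L (Iio l), (∀ a ∈ frBar (Iic α), t a = s a) ∧
      ∀ γ, α < γ → IsNeutralAt S f g c t γ := by
  let Q := {p : Set (Iio l) × L (Iio l) // IsLowerSet p.1 ∧ α ∈ p.1 ∧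
    (∀ a ∈ frBar (Iic α), p.2 a = s a) ∧ ∀ γ ∈ p.1, α < γ → IsNeutralAt S f g c p.2 γ}
  let r : Q → Q → Prop := fun p q => p.1.1 ⊆ q.1.1 ∧
    ∀ γ ∈ p.1.1, ∀ a ∈ frBar (Iic γ), q.1.2 a = p.1.2 a
  have hQ : Nonempty Q := ⟨⟨(Iic α, s), isLowerSet_Iic α, mem_Iic.2 le_rfl, fun _ _ => rfl,
    fun γ hγ hγ' => (not_lt.2 (mem_Iic.1 hγ) hγ').elim⟩⟩
  obtain ⟨m, hm⟩ := exists_maximal_of_nonempty_chains_bounded (r := r) (by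
      intro C hC hCn
      have : Nonempty C := hCn.to_subtype
      have hr : ∀ p q : C, r p q ∨ r q p := fun p q => by
        by_cases hpq : p = q
        · exact Or.inl ⟨by rw [hpq], fun γ _ a _ => by rw [hpq]⟩
        · exact hC p.2 q.2 fun h => hpq (Subtype.ext h)
      let D : C → Set (L (Iio l)) := fun p =>
        ⋂ γ ∈ p.1.1.1, ⋂ a ∈ frBar (Iic γ), {t : L (Iio l) | t a = p.1.1.2 a}
      have memD : ∀ (p : C) (t : L (Iio l)), t ∈ D p ↔
          ∀ γ ∈ p.1.1.1, ∀ a ∈ frBar (Iic γ), t a = p.1.1.2 a := fun p t => by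
        simp only [D, mem_iInter, mem_ofPred_eq]
      have hD : ∀ p, IsClosed (D p) := fun p => isClosed_biInter fun γ _ =>
        isClosed_biInter fun a _ => isClosed_eq (StoneSpace.continuous_eval a) continuous_const
      have hrD : ∀ p q : C, r p q → D q ⊆ D p := fun p q hpq t ht => (memD p t).2 fun γ hγ a ha =>
        ((memD q t).1 ht γ (hpq.1 hγ) a ha).trans (hpq.2 γ hγ a ha)
      obtain ⟨t, ht⟩ := IsCompact.nonempty_iInter_of_directed_nonempty_isCompact_isClosed D
        (fun p q => (hr p q).elim (fun h => ⟨q, hrD p q h, subset_rfl⟩)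
          fun h => ⟨p, subset_rfl, hrD q p h⟩)
        (fun p => ⟨p.1.1.2, (memD p _).2 fun _ _ _ _ => rfl⟩) (fun p => (hD p).isCompact) hD
      have ht' : ∀ p ∈ C, ∀ γ ∈ p.1.1, ∀ a ∈ frBar (Iic γ), t a = p.1.2 a := fun p hp =>
        (memD ⟨p, hp⟩ t).1 (mem_iInter.1 ht ⟨p, hp⟩)
      obtain ⟨p, hp⟩ := hCn
      refine ⟨⟨(⋃ p ∈ C, p.1.1, t), isLowerSet_iUnion₂ fun q _ => q.2.1,
        mem_biUnion hp p.2.2.1, fun a ha => (ht' p hp α p.2.2.1 a ha).trans (p.2.2.2.1 a ha),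
        fun γ hγ hαγ => ?_⟩, fun q hq => ⟨subset_biUnion_of_mem (u := fun q : Q => q.1.1) hq,
          ht' q hq⟩⟩
      obtain ⟨q, hq, hγq⟩ := mem_iUnion₂.1 hγ
      exact (q.2.2.2.2 γ hγq hαγ).congr h fun a ha => (ht' q hq γ hγq a ha).symm)
    (fun {p q r} hpq hqr => ⟨hpq.1.trans hqr.1, fun γ hγ a ha =>
      (hqr.2 γ (hpq.1 hγ) a ha).trans (hpq.2 γ hγ a ha)⟩)
  obtain ⟨⟨I, t⟩, hI, hα, hts, htn⟩ := m
  suffices hIu : ∀ γ, γ ∈ I from ⟨t, hts, fun γ => htn γ (hIu γ)⟩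
  intro γ
  induction γ using WellFoundedLT.induction with
  | ind δ ih =>
    by_contra hδ
    have hαδ : ∀ γ ∈ I, γ < δ := fun γ hγ => lt_of_not_ge fun hle => hδ (hI hle hγ)
    obtain ⟨t', htt', hn⟩ := exists_isNeutralAt h c t δ
    have hlow : IsLowerSet (insert δ I) := by
      rintro x y hyx (rfl | hx)
      · exact hyx.eq_or_lt.elim Or.inl fun hlt => Or.inr (ih y hlt)
      · exact Or.inr (hI hyx hx)
    have hmem := (hm ⟨(insert δ I, t'), hlow, Or.inr hα,
      fun a ha => (htt' α (hαδ α hα) a ha).trans (hts a ha), by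
        rintro γ (rfl | hγ) hαγ
        · exact hn
        · exact (htn γ hγ hαγ).congr h fun a ha => (htt' γ (hαδ γ hγ) a ha).symm⟩
      ⟨subset_insert _ _, fun γ hγ => htt' γ (hαδ γ hγ)⟩).1 (mem_insert δ I)
    exact hδ hmem

end Points

/-! ### Generated algebras, extremal disconnectedness and closures in `∇𝓕` -/

theorem apply_eq_apply_of_mem_alg {X : Type u} [TopologicalSpace X] [CompactSpace X]
    {G : Set C(X, ℝ)} {s t : X} (h : ∀ f ∈ G, f s = f t) {f : C(X, ℝ)} (hf : f ∈ alg G) :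
    f s = f t := by
  have hle : Algebra.adjoin ℝ G ≤
      AlgHom.equalizer (ContinuousMap.evalAlgHom ℝ ℝ s) (ContinuousMap.evalAlgHom ℝ ℝ t) :=
    Algebra.adjoin_le h
  have hf' : f ∈ closure (Algebra.adjoin ℝ G : Set C(X, ℝ)) := hf
  exact closure_minimal (t := {f : C(X, ℝ) | f s = f t}) (fun f hf => hle hf)
    (isClosed_eq (continuous_eval_const s) (continuous_eval_const t))
    hf'

/-- Every open subset of `L` has a closure of the form `[a]`. -/
theorem exists_closure_eq {J : Type u} {W : Set (L J)} (hW : IsOpen W) :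
    ∃ a : FrBar J, closure W = {t : L J | t a = true} := by
  -- The join of all `b` with `[b] ⊆ W`. An element `v` with `[v]` disjoint from `W` is disjoint
  -- from every such `b`, hence from the join.
  let D : Opens (Cube J) := sSup {u | ∃ b : FrBar J, b.val = u ∧ ∀ t : L J, t b = true → t ∈ W}
  have hD : ∀ b : FrBar J, (∀ t : L J, t b = true → t ∈ W) → b ≤ Heyting.Regular.toRegular D :=
    fun b hb => (show b.val ≤ D from le_sSup ⟨b, rfl, hb⟩).trans (Heyting.Regular.gi.gc.le_u_l D)
  refine ⟨Heyting.Regular.toRegular D, subset_antisymm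
    (closure_minimal (fun t ht => ?_) (StoneSpace.isClopen _).isClosed) fun t ht => ?_⟩
  · obtain ⟨b, htb, hb⟩ := StoneSpace.exists_of_isOpen hW ht
    exact StoneSpace.apply_mono (hD b hb) htb
  · refine mem_closure_iff.2 fun V hV htV => ?_
    obtain ⟨v, htv, hv⟩ := StoneSpace.exists_of_isOpen hV htV
    by_contra hne
    have hle : Heyting.Regular.toRegular D ≤ vᶜ := by
      refine Heyting.Regular.gi.gc.l_le (sSup_le ?_)
      rintro _ ⟨b, rfl, hb⟩
      change b ≤ vᶜ
      rw [le_compl_iff_disjoint_right, disjoint_iff]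
      by_contra hbv
      obtain ⟨y, hy⟩ := StoneSpace.exists_apply_eq_true hbv
      rw [StoneSpace.apply_inf_eq_true] at hy
      exact hne ⟨y, hv y hy.2, hb y hy.1⟩
    have := StoneSpace.apply_compl_eq_true.1 (StoneSpace.apply_mono hle ht)
    simp [htv] at this

/-- The canonical map of `L` onto `∇𝓕`. -/
def toNabla {X : Type u} [TopologicalSpace X] (𝓕 : Set C(X, ℝ)) (x : X) : nabla 𝓕 :=
  ⟨fun f => f.1 x, mem_range_self x⟩

theorem continuous_toNabla {X : Type u} [TopologicalSpace X] (𝓕 : Set C(X, ℝ)) :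
    Continuous (toNabla 𝓕) :=
  (continuous_pi fun f : 𝓕 => f.1.continuous).subtype_mk _

theorem surjective_toNabla {X : Type u} [TopologicalSpace X] (𝓕 : Set C(X, ℝ)) :
    Function.Surjective (toNabla 𝓕) := by
  rintro ⟨_, x, rfl⟩
  exact ⟨x, rfl⟩

theorem closure_eq_image_toNabla {X : Type u} [TopologicalSpace X] [CompactSpace X]
    (𝓕 : Set C(X, ℝ)) (U : Set (nabla 𝓕)) :
    closure U = toNabla 𝓕 '' closure (toNabla 𝓕 ⁻¹' U) := by
  rw [image_closure_of_isCompact isClosed_closure.isCompact (continuous_toNabla 𝓕).continuousOn,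
    image_preimage_eq U (surjective_toNabla 𝓕)]

theorem exists_subset_Iic_of_countable {κ : Cardinal.{u}} (hκ : κ.IsRegular)
    (hκ' : Cardinal.aleph0 < κ) {A : Set (Iio κ.ord)} (hA : A.Countable) :
    ∃ α : Iio κ.ord, A ⊆ Iic α := by
  rcases A.eq_empty_or_nonempty with rfl | hne
  · exact ⟨⟨0, hκ.ord_pos⟩, empty_subset _⟩
  · obtain ⟨e, rfl⟩ := hA.exists_eq_range hne
    have h : ⨆ n, (e n : Ordinal.{u}) < κ.ord := by
      refine Ordinal.lift_iSup_lt_of_lt_cof ?_ fun n => (e n).2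
      simpa [hκ.cof_ord] using hκ'
    refine ⟨⟨_, h⟩, ?_⟩
    rintro _ ⟨n, rfl⟩
    exact Ordinal.le_iSup (fun n => (e n : Ordinal.{u})) n

/-! ### Agreement of neutral points on the whole family -/

section Agreement

variable {l : Ordinal.{u}} {𝓕 : Set C(L (Iio l), ℝ)} {S : Set (Iio l)}
  {ν : Iio l → ℕ → ℤˣ} {η : Iio l → ℕ → Iio l} {f : Iio l → ℕ → C(L (Iio l), ℝ)}
  {β : Iio l → Iio l} {M : Iio l → Set ℕ} {g : Iio l → C(L (Iio l), ℝ)}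

/-- Points which agree on the members of the family of index at most `α`, and are neutral at all
larger indices, agree on the whole family. -/
theorem IsLadderFamilyWith.apply_eq_apply (h : IsLadderFamilyWith 𝓕 S ν η f β M g) {c : Bool}
    {s t : L (Iio l)} {α : Iio l} (hst : ∀ φ ∈ fragment S g (Iic α), φ s = φ t)
    (hs : ∀ γ, α < γ → IsNeutralAt S f g c s γ) (ht : ∀ γ, α < γ → IsNeutralAt S f g c t γ) :
    ∀ φ ∈ 𝓕, φ s = φ t := by
  have hd : ∀ γ, d γ s = d γ t := fun γ => by
    rcases le_or_gt γ α with hγ | hγ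
    · exact hst _ (Or.inl (mem_image_of_mem _ hγ))
    · rw [d_eq_of_forall (hs γ hγ).1, d_eq_of_forall (ht γ hγ).1]
  have hg : ∀ γ, γ ∈ S → g γ s = g γ t := fun γ => by
    induction γ using WellFoundedLT.induction with
    | ind γ ih =>
      intro hS
      rcases le_or_gt γ α with hγ | hγ
      · exact hst _ (Or.inr (mem_image_of_mem _ ⟨hγ, hS⟩))
      -- The `f γ n` belong to the algebra generated by members of index below `β γ`, where
      -- agreement is already known.
      · refine apply_eq_apply_of_isLUB_disjoint (h.isLUB_g γ hS) (h.infinite_M γ hS)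
          (h.f_disjoint γ hS) (fun n => apply_eq_apply_of_mem_alg ?_ (h.f_mem γ hS n))
          (fun n => ?_) ((hs γ hγ).2 hS) ((ht γ hγ).2 hS)
        · rintro _ (⟨δ, -, rfl⟩ | ⟨δ, ⟨hδ, hδS⟩, rfl⟩)
          · exact hd δ
          · exact ih δ (lt_trans hδ (h.beta_lt γ hS)) hδS
        · rw [dSigned_apply, dSigned_apply, hd]
  intro φ hφ
  rw [h.eq_fragment] at hφ
  obtain ⟨γ, -, rfl⟩ | ⟨γ, ⟨-, hγ⟩, rfl⟩ := hφ
  · exact hd γ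
  · exact hg γ hγ

theorem IsLadderFamilyWith.dependsOn_of_mem_fragment (h : IsLadderFamilyWith 𝓕 S ν η f β M g)
    {α : Iio l} {φ : C(L (Iio l), ℝ)} (hφ : φ ∈ fragment S g (Iic α)) : DependsOn φ (Iic α) := by
  obtain ⟨γ, hγ, rfl⟩ | ⟨γ, ⟨hγ, hγS⟩, rfl⟩ := hφ
  · exact (dependsOn_d γ).mono (singleton_subset_iff.2 hγ)
  · exact (h.dependsOn_g hγS).mono (Iio_subset_Iic_self.trans (Iic_subset_Iic.2 hγ))

theorem IsLadderFamilyWith.d_mem (h : IsLadderFamilyWith 𝓕 S ν η f β M g) (γ : Iio l) :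
    d γ ∈ 𝓕 := by
  rw [h.eq_fragment]
  exact Or.inl (mem_image_of_mem _ trivial)

theorem IsLadderFamilyWith.fragment_subset (h : IsLadderFamilyWith 𝓕 S ν η f β M g)
    (B : Set (Iio l)) : fragment S g B ⊆ 𝓕 := by
  rw [h.eq_fragment]
  exact union_subset_union (image_mono (subset_univ _))
    (image_mono (inter_subset_inter_left _ (subset_univ _)))

end Agreement

end Ladder

end

/-! ### The theorem -/

theorem lemma4p7 (κ : Cardinal.{u}) (hκ : κ.IsRegular) (hκ' : Cardinal.aleph0 < κ)
    (𝓕 : Set C(Ladder.L (Set.Iio κ.ord), ℝ)) (h𝓕 : Ladder.IsLadderFamily 𝓕) :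
    ∀ x : Ladder.nabla 𝓕, ¬ Ladder.IsButterflyPoint x := by
  rintro x ⟨U, V, hU, hV, -, hUV⟩
  obtain ⟨S, ν, η, f, β, M, g, h⟩ := h𝓕
  obtain ⟨a, ha⟩ := Ladder.exists_closure_eq (hU.preimage (Ladder.continuous_toNabla 𝓕))
  obtain ⟨b, hb⟩ := Ladder.exists_closure_eq (hV.preimage (Ladder.continuous_toNabla 𝓕))
  have hxU : x ∈ closure U := (hUV.ge rfl).1
  have hxV : x ∈ closure V := (hUV.ge rfl).2
  rw [Ladder.closure_eq_image_toNabla, ha] at hxU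
  rw [Ladder.closure_eq_image_toNabla, hb] at hxV
  obtain ⟨s, hs, rfl⟩ := hxU
  obtain ⟨t, ht, hts⟩ := hxV
  obtain ⟨A, hA, haA⟩ := Ladder.exists_countable_mem_frBar a
  obtain ⟨B, hB, hbB⟩ := Ladder.exists_countable_mem_frBar b
  obtain ⟨α, hα⟩ := Ladder.exists_subset_Iic_of_countable hκ hκ' (hA.union hB)
  let γ : Set.Iio κ.ord := ⟨Order.succ α, (Cardinal.isSuccLimit_ord hκ.aleph0_le).succ_lt α.2⟩
  have hγ : α < γ := Order.lt_succ (α : Ordinal.{u})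
  -- At least one of `0` and `1` differs from the value of `d γ` at `s`, which is its value at `x`.
  obtain ⟨c, hc⟩ : ∃ c : Bool, Ladder.d γ s ≠ bif c then 1 else 0 := by
    by_cases h0 : Ladder.d γ s = 0
    · exact ⟨true, by simp [h0]⟩
    · exact ⟨false, h0⟩
  obtain ⟨s', hss', hs'⟩ := Ladder.exists_isNeutralAt_of_gt h c s α
  obtain ⟨t', htt', ht'⟩ := Ladder.exists_isNeutralAt_of_gt h c t α
  have hst : ∀ φ ∈ 𝓕, φ t = φ s := fun φ hφ => congrFun (congrArg Subtype.val hts) ⟨φ, hφ⟩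
  have hst' : ∀ φ ∈ 𝓕, φ t' = φ s' := h.apply_eq_apply (fun φ hφ => by
    rw [(h.dependsOn_of_mem_fragment hφ).eq hss', (h.dependsOn_of_mem_fragment hφ).eq htt',
      hst φ (h.fragment_subset _ hφ)]) ht' hs'
  have hmem : Ladder.toNabla 𝓕 s' ∈ closure U ∩ closure V := by
    rw [Ladder.closure_eq_image_toNabla, Ladder.closure_eq_image_toNabla, ha, hb]
    refine ⟨⟨s', (hss' a (Ladder.frBar_mono (subset_union_left.trans hα) haA)).trans hs, rfl⟩, t',
      (htt' b (Ladder.frBar_mono (subset_union_right.trans hα) hbB)).trans ht, ?_⟩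
    exact Subtype.ext (funext fun φ => hst' φ.1 φ.2)
  rw [hUV] at hmem
  have := congrFun (congrArg Subtype.val (mem_singleton_iff.1 hmem)) ⟨_, h.d_mem γ⟩
  exact hc (this.symm.trans (Ladder.d_eq_of_forall (hs' γ hγ).1))
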